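/- For a finite non-empty simple graph $G=(V,E)$, let $\mathrm{nd}(G)$ (the neighborhood diversity) be the least $t$ such that $V$ can be partitioned into $t$ non-empty sets $V_1,\dots,V_t$ with the property that, for every vertex $v$ and every $i$, either $v$ is adjacent to every vertex of $V_i\setminus\{v\}$ or $v$ is adjacent to no vertex of $V_i$ (so each $V_i$ is a clique or an independent set); call any partition with this property a neighborhood partition. A graph is well-covered if every maximal independent set is also maximum. Then: 1. The problem Well-Covered Graph parameterized by neighborhood diversity, that is, the language $L\subseteq\{0,1\}^*\times\mathbb N$ of all pairs $(\langle G\rangle,k)$ such that $G$ is a non-empty well-covered graph with $\mathrm{nd}(G)=k$ (where $\langle G\rangle$ encodes $G$ by its adjacency matrix), is fixed-parameter tractable: there are an algorithm, a computable function $f$ and a constant $c$ such that the algorithm decides every instance $I=(x,k)$ in time at most $f(k)\,|I|^{c}$. 2. There is an algorithm that, given only a graph $G$ on $n\ge 1$ vertices, decides whether $G$ is well-covered in time $2^{\mathrm{nd}(G)}\,n^{O(1)}$. 3. Let $V_1,\dots,V_t$ be a neighborhood partition of $G$, and contract each $V_i$ to a single vertex $v_i$, of weight $1$ if $V_i$ is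 a clique and of weight $|V_i|$ otherwise, with $v_i$ and $v_j$ ($i\ne j$) adjacent if and only if $G$ has an edge between $V_i$ and $V_j$. Then $G$ is well-covered if and only if all maximal independent sets of the contracted graph have the same total weight. Running times are numbers of steps of a unit-cost random access machine with addition and cut-off subtraction. -/

import Mathlib

namespace WellCovered

/-! ### Random access machines

Programs of a unit-cost random access machine, working on natural numbers that are stored in
scalar registers and in arrays.  A program mentions only finitely many registers and arrays. -/

/-- The contents of the memory: register `r` holds `reg r`, and cell `i` of array `a` holds
`arr a i`. -/
structure Store where
  reg : ℕ → ℕ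
  arr : ℕ → ℕ → ℕ

/-- The instructions (subtraction is cut off at `0`). There is no multiplication. -/
inductive Instr where
  /-- `reg d := c` -/
  | const (d c : ℕ)
  /-- `reg d := reg a` -/
  | copy (d a : ℕ)
  /-- `reg d := reg a + reg b` -/
  | add (d a b : ℕ)
  /-- `reg d := reg a - reg b` -/
  | sub (d a b : ℕ)
  /-- `reg d := arr t (reg a)` -/
  | read (d t a : ℕ)
  /-- `arr t (reg a) := reg b` -/
  | write (t a b : ℕ)

/-- The effect of one instruction on the memory. -/
def Instr.apply : Instr → Store → Store
  | .const d c, s => { s with reg := Function.update s.reg d c }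
  | .copy d a, s => { s with reg := Function.update s.reg d (s.reg a) }
  | .add d a b, s => { s with reg := Function.update s.reg d (s.reg a + s.reg b) }
  | .sub d a b, s => { s with reg := Function.update s.reg d (s.reg a - s.reg b) }
  | .read d t a, s => { s with reg := Function.update s.reg d (s.arr t (s.reg a)) }
  | .write t a b, s =>
      { s with arr := Function.update s.arr t (Function.update (s.arr t) (s.reg a) (s.reg b)) }

/-- Programs: single instructions, sequential composition, `if reg r ≠ 0 then p else q`, and
`while reg r ≠ 0 do p`. -/
inductive Prog where
  | op (i : Instr)
  | seq (p q : Prog)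
  | cond (r : ℕ) (p q : Prog)
  | loop (r : ℕ) (p : Prog)

/-- `Exec p s t s'`: started with memory `s`, the program `p` halts after exactly `t` steps with
memory `s'`.  Each instruction and each evaluation of a test is one step. -/
inductive Exec : Prog → Store → ℕ → Store → Prop
  | op (i : Instr) (s : Store) : Exec (.op i) s 1 (i.apply s)
  | seq {p q : Prog} {s s' s'' : Store} {t t' : ℕ} :
      Exec p s t s' → Exec q s' t' s'' → Exec (.seq p q) s (t + t') s''
  | cond_true {r : ℕ} {p q : Prog} {s s' : Store} {t : ℕ} :
      s.reg r ≠ 0 → Exec p s t s' → Exec (.cond r p q) s (t + 1) s'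
  | cond_false {r : ℕ} {p q : Prog} {s s' : Store} {t : ℕ} :
      s.reg r = 0 → Exec q s t s' → Exec (.cond r p q) s (t + 1) s'
  | loop_stop {r : ℕ} {p : Prog} {s : Store} :
      s.reg r = 0 → Exec (.loop r p) s 1 s
  | loop_step {r : ℕ} {p : Prog} {s s' s'' : Store} {t t' : ℕ} :
      s.reg r ≠ 0 → Exec p s t s' → Exec (.loop r p) s' t' s'' →
        Exec (.loop r p) s (t + t' + 1) s''

/-- The initial memory on input `(x, k)`: array `0` holds the bits of `x`, register `0` holds the
length of `x`, register `1` holds `k`, and everything else is `0`. -/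
def initStore (x : List Bool) (k : ℕ) : Store where
  reg r := if r = 0 then x.length else if r = 1 then k else 0
  arr a i := if a = 0 ∧ x[i]? = some true then 1 else 0

/-- On input `(x, k)`, the program `P` halts within `T` steps, and it accepts (leaves a nonzero
number in register `0`) if and only if `A` holds. -/
def Prog.AnswersWithin (P : Prog) (x : List Bool) (k : ℕ) (A : Prop) (T : ℕ) : Prop :=
  ∃ (t : ℕ) (s : Store), Exec P (initStore x k) t s ∧ t ≤ T ∧ (s.reg 0 ≠ 0 ↔ A)

/-! ### Fixed-parameter tractability -/

/-- The size of an instance `(x, k)`, with the parameter written in unary behind a separator. -/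
def instanceSize (x : List Bool) (k : ℕ) : ℕ := x.length + 1 + k

/-- A parameterized problem, i.e. a language `L ⊆ {0,1}* × ℕ`, is fixed-parameter tractable if,
for a computable function `f` and a constant `c`, some program decides every instance `I = (x, k)`
within `f k * |I| ^ c` steps. -/
def IsFPT (L : Set (List Bool × ℕ)) : Prop :=
  ∃ (P : Prog) (f : ℕ → ℕ) (c : ℕ), Computable f ∧
    ∀ (x : List Bool) (k : ℕ), P.AnswersWithin x k ((x, k) ∈ L) (f k * instanceSize x k ^ c)

/-! ### Graphs -/

/-- A graph is well-covered if every maximal independent set is also maximum. -/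
def IsWellCovered {V : Type*} [Fintype V] (G : SimpleGraph V) : Prop :=
  ∀ S : Finset V, Maximal G.IsIndepSet (S : Set V) → G.IsMaximumIndepSet S

/-- The fibres of `p` are a partition of the vertices into `t` nonempty parts such that every
vertex `v` is, for each part, either adjacent to all vertices of the part (other than `v` itself)
or to none of them. -/
def IsNeighborhoodPartition {V : Type*} (G : SimpleGraph V) {t : ℕ} (p : V → Fin t) : Prop :=
  Function.Surjective p ∧
    ∀ (v : V) (i : Fin t),
      (∀ u, p u = i → u ≠ v → G.Adj v u) ∨ (∀ u, p u = i → ¬ G.Adj v u)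

/-- The neighborhood diversity: the least number of parts of a neighborhood partition. (For a
finite graph the set is nonempty, since the partition into singletons qualifies.) -/
noncomputable def neighborhoodDiversity {V : Type*} (G : SimpleGraph V) : ℕ :=
  sInf {t : ℕ | ∃ p : V → Fin t, IsNeighborhoodPartition G p}

/-- The graph obtained from `G` by contracting each part to a single vertex. -/
def quotientGraph {V : Type*} (G : SimpleGraph V) {t : ℕ} (p : V → Fin t) :
    SimpleGraph (Fin t) where
  Adj i j := i ≠ j ∧ ∃ u v, p u = i ∧ p v = j ∧ G.Adj u v
  symm := ⟨fun _ _ ⟨hij, u, v, hu, hv, h⟩ => ⟨hij.symm, v, u, hv, hu, h.symm⟩⟩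
  loopless := ⟨fun _ h => h.1 rfl⟩

open Classical in
/-- The weight of a contracted part: `1` for a clique, and the size of the part otherwise. -/
noncomputable def partWeight {V : Type*} (G : SimpleGraph V) {t : ℕ} (p : V → Fin t)
    (i : Fin t) : ℕ :=
  if G.IsClique (p ⁻¹' {i}) then 1 else (p ⁻¹' {i}).ncard

/-! ### The problem -/

open Classical in
/-- The encoding of a graph on `n` vertices by a bit string: `n` in unary, a separator, and the
adjacency matrix row by row. -/
noncomputable def encodeGraph {n : ℕ} (G : SimpleGraph (Fin n)) : List Bool :=
  List.replicate n true ++ false :: List.ofFn fun e : Fin (n * n) =>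
    decide (G.Adj e.divNat e.modNat)

/-- Well-Covered Graph parameterized by neighborhood diversity: the pairs `(x, k)` such that `x`
encodes a (nonempty) well-covered graph whose neighborhood diversity is `k`. -/
def wellCoveredByND : Set (List Bool × ℕ) :=
  {I | ∃ (n : ℕ) (G : SimpleGraph (Fin n)), 1 ≤ n ∧ I.1 = encodeGraph G ∧
    neighborhoodDiversity G = I.2 ∧ IsWellCovered G}

end WellCovered

/-! Vertices in one part of a neighborhood partition are twins: no third vertex tells them apart.
Conversely, being twins is an equivalence relation, and any partition into sets of mutual twins is a
neighborhood partition. So the twin classes form the coarsest one, and the neighborhood diversity is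
their number (`neighborhoodDiversity_eq`).

A maximal independent set that meets a part contains exactly one of its vertices if the part is a
clique, and the whole part otherwise. Its image in the contracted graph is therefore maximal
independent, with weight equal to its size (`sum_partWeight_image`), and every maximal independent
set of the contracted graph arises in this way (`maximal_liftSet`). Well-coveredness says that all
maximal independent sets have the same size, whence `isWellCovered_iff_quotient`.

For the algorithm, the binary digits of each `m < 2 ^ nd(G)` select twin classes and hence a
candidate set. The maximal independent candidates realize all sizes that occur
(`isWellCovered_iff_candidate`), so one loop over `m` that compares sizes suffices. Its body is
polynomial by closure properties of `PolyTime`: the inner loops run once per input bit, and only the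
main loop (`fold_computes`) may be longer. `PolyTime` asks for a program at every placement of the
context, so that subprograms can work above the registers already in use. -/

namespace WellCovered

/-! ### Functions computed in polynomial time -/

section PolyTime

open Polynomial

/-- A type of contexts: an input word together with finitely many natural numbers. -/
class Ctx (α : Type) where
  arity : ℕ
  val : α → ℕ → ℕ
  inp : α → List Bool

instance : Ctx (List Bool) where
  arity := 0
  val _ _ := 0
  inp x := x

/-- The new number takes the last index, so the older numbers keep their indices, and with them
their registers, inside a loop body. -/
instance {α : Type} [Ctx α] : Ctx (α × ℕ) where
  arity := Ctx.arity α + 1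
  val p j := if j < Ctx.arity α then Ctx.val p.1 j else p.2
  inp p := Ctx.inp p.1

variable {α : Type} [Ctx α]

/-- The length of the input word of a context. -/
def len (a : α) : ℕ := (Ctx.inp a).length

@[simp] theorem len_prod (p : α × ℕ) : len p = len p.1 := rfl

/-- The memory `s` holds the context `a`, with its `j`-th number in register `l j`. -/
structure Store.Represents (s : Store) (l : ℕ → ℕ) (a : α) : Prop where
  len : s.reg 0 = len a
  bits : ∀ i, s.arr 0 i = if (Ctx.inp a)[i]? = some true then 1 else 0
  vals : ∀ j < Ctx.arity α, s.reg (l j) = Ctx.val a j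

/-- `Computes P d s v T`: from `s`, the program `P` halts within `T` steps, having changed nothing
but registers `≥ d`, and register `d` then holds `v`. -/
def Computes (P : Prog) (d : ℕ) (s : Store) (v T : ℕ) : Prop :=
  ∃ t s', Exec P s t s' ∧ t ≤ T ∧ s'.reg d = v ∧ (∀ r < d, s'.reg r = s.reg r) ∧ s'.arr = s.arr

/-- The function `f` of the context is computed in time polynomial in the length of the input,
for every placement of the context in the registers below a scratch area. -/
def PolyTime (f : α → ℕ) : Prop :=
  ∃ T : ℕ[X], ∀ (d : ℕ) (l : ℕ → ℕ), 0 < d → (∀ j < Ctx.arity α, l j < d) →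
    ∃ P : Prog, ∀ (a : α) (s : Store), s.Represents l a → Computes P d s (f a) (T.eval (len a))

theorem Store.Represents.congr {s s' : Store} {l : ℕ → ℕ} {a : α} {d : ℕ}
    (h : s.Represents l a) (hd : 0 < d) (hl : ∀ j < Ctx.arity α, l j < d)
    (hr : ∀ r < d, s'.reg r = s.reg r) (ha : s'.arr = s.arr) : s'.Represents l a where
  len := by rw [hr 0 hd, h.len]
  bits := by rw [ha]; exact h.bits
  vals j hj := by rw [hr _ (hl j hj), h.vals j hj]

/-- The placement `l` of a context extended by one number in register `d`. -/
def pushLayout (α : Type) [Ctx α] (l : ℕ → ℕ) (d : ℕ) : ℕ → ℕ :=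
  fun j => if j < Ctx.arity α then l j else d

theorem pushLayout_lt {l : ℕ → ℕ} {d : ℕ} (hl : ∀ j < Ctx.arity α, l j < d) :
    ∀ j < Ctx.arity (α × ℕ), pushLayout α l d j < d + 1 := by
  intro j _
  unfold pushLayout
  split_ifs with h
  · exact (hl j h).trans (Nat.lt_succ_self d)
  · exact Nat.lt_succ_self d

theorem Store.Represents.push {s : Store} {l : ℕ → ℕ} {a : α} {d v : ℕ}
    (h : s.Represents l a) (hv : s.reg d = v) :
    s.Represents (pushLayout α l d) (a, v) where
  len := h.len
  bits := h.bits
  vals j _ := by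
    by_cases hj : j < Ctx.arity α
    · simpa [pushLayout, Ctx.val, hj] using h.vals j hj
    · simpa [pushLayout, Ctx.val, hj] using hv

/-! #### Basic programs -/

theorem PolyTime.const (c : ℕ) : PolyTime fun _ : α => c := by
  refine ⟨1, fun d l _ _ => ⟨.op (.const d c), fun a s _ => ⟨1, _, .op _ _, by simp, ?_, ?_, rfl⟩⟩⟩
  · simp [Instr.apply]
  · intro r hr
    simp [Instr.apply, hr.ne]

theorem PolyTime.len : PolyTime fun a : α => len a := by
  refine ⟨1, fun d l _ _ => ⟨.op (.copy d 0), fun a s h => ⟨1, _, .op _ _, by simp, ?_, ?_, rfl⟩⟩⟩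
  · simp [Instr.apply, h.len]
  · intro r hr
    simp [Instr.apply, hr.ne]

theorem PolyTime.snd : PolyTime fun p : α × ℕ => p.2 := by
  refine ⟨1, fun d l _ _ => ⟨.op (.copy d (l (Ctx.arity α))), fun a s h =>
    ⟨1, _, .op _ _, by simp, ?_, ?_, rfl⟩⟩⟩
  · have := h.vals (Ctx.arity α) (Nat.lt_succ_self _)
    simp [Instr.apply, this, Ctx.val]
  · intro r hr
    simp [Instr.apply, hr.ne]

theorem PolyTime.fst {f : α → ℕ} (hf : PolyTime f) : PolyTime fun p : α × ℕ => f p.1 := by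
  obtain ⟨T, hT⟩ := hf
  refine ⟨T, fun d l hd hl => ?_⟩
  obtain ⟨P, hP⟩ := hT d l hd fun j hj => hl j (Nat.lt_succ_of_lt hj)
  refine ⟨P, fun a s h => hP a.1 s ⟨h.len, h.bits, fun j hj => ?_⟩⟩
  rw [h.vals j (Nat.lt_succ_of_lt hj)]
  exact if_pos hj

theorem PolyTime.congr {f g : α → ℕ} (hf : PolyTime f) (h : ∀ a, f a = g a) : PolyTime g := by
  rwa [← funext h]

/-- Compute two values, the second one register higher, and combine them by one instruction. -/
theorem PolyTime.binop {f g : α → ℕ} (hf : PolyTime f) (hg : PolyTime g) (o : ℕ → ℕ → ℕ)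
    (i : ℕ → Instr)
    (hi : ∀ d s, (i d).apply s =
      { s with reg := Function.update s.reg d (o (s.reg d) (s.reg (d + 1))) }) :
    PolyTime fun a => o (f a) (g a) := by
  obtain ⟨T, hT⟩ := hf
  obtain ⟨U, hU⟩ := hg
  refine ⟨T + U + 1, fun d l hd hl => ?_⟩
  obtain ⟨P, hP⟩ := hT d l hd hl
  obtain ⟨Q, hQ⟩ := hU (d + 1) l (Nat.succ_pos d) fun j hj => (hl j hj).trans (Nat.lt_succ_self d)
  refine ⟨.seq P (.seq Q (.op (i d))), fun a s h => ?_⟩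
  obtain ⟨t, s', he, ht, hv, hr, ha⟩ := hP a s h
  obtain ⟨t', s'', he', ht', hv', hr', ha'⟩ := hQ a s' (h.congr hd hl hr ha)
  refine ⟨_, _, he.seq (he'.seq (.op _ _)), ?_, ?_, ?_, ?_⟩
  · simp only [eval_add, eval_one]; omega
  · simp [hi, hv', hr' d (Nat.lt_succ_self d), hv]
  · intro r hrd
    simp [hi, hrd.ne, hr' r (hrd.trans (Nat.lt_succ_self d)), hr r hrd]
  · simp [hi, ha', ha]

theorem PolyTime.add {f g : α → ℕ} (hf : PolyTime f) (hg : PolyTime g) :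
    PolyTime fun a => f a + g a :=
  hf.binop hg (· + ·) (fun d => .add d d (d + 1)) fun _ _ => rfl

theorem PolyTime.sub {f g : α → ℕ} (hf : PolyTime f) (hg : PolyTime g) :
    PolyTime fun a => f a - g a :=
  hf.binop hg (· - ·) (fun d => .sub d d (d + 1)) fun _ _ => rfl

theorem PolyTime.ite_ne_zero {c f g : α → ℕ} (hc : PolyTime c) (hf : PolyTime f)
    (hg : PolyTime g) : PolyTime fun a => if c a ≠ 0 then f a else g a := by
  obtain ⟨R, hR⟩ := hc
  obtain ⟨T, hT⟩ := hf
  obtain ⟨U, hU⟩ := hg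
  refine ⟨R + T + U + 1, fun d l hd hl => ?_⟩
  obtain ⟨O, hO⟩ := hR d l hd hl
  obtain ⟨P, hP⟩ := hT d l hd hl
  obtain ⟨Q, hQ⟩ := hU d l hd hl
  refine ⟨.seq O (.cond d P Q), fun a s h => ?_⟩
  obtain ⟨t, s', he, ht, hv, hr, ha⟩ := hO a s h
  have h' := h.congr hd hl hr ha
  by_cases hca : c a = 0
  · obtain ⟨t', s'', he', ht', hv', hr', ha'⟩ := hQ a s' h'
    refine ⟨_, _, he.seq (.cond_false (hv.trans hca) he'), ?_, ?_, ?_, ha'.trans ha⟩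
    · simp only [eval_add, eval_one]; omega
    · simp [hca, hv']
    · intro r hrd
      rw [hr' r hrd, hr r hrd]
  · obtain ⟨t', s'', he', ht', hv', hr', ha'⟩ := hP a s' h'
    refine ⟨_, _, he.seq (.cond_true (hv.symm ▸ hca) he'), ?_, ?_, ?_, ha'.trans ha⟩
    · simp only [eval_add, eval_one]; omega
    · simp [hca, hv']
    · intro r hrd
      rw [hr' r hrd, hr r hrd]

/-! #### Loops -/

/-- Iterate `g (n - 1), …, g 1, g 0`, in this order. -/
def downFold (g : ℕ → ℕ → ℕ) : ℕ → ℕ → ℕ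
  | 0, acc => acc
  | n + 1, acc => downFold g n (g n acc)

/-- Register `d` counts down, and register `d + 1` is updated by `B`, which leaves its result in
register `d + 2`. -/
def countdown (d : ℕ) (B : Prog) : Prog :=
  .loop d (.seq (.op (.const (d + 2) 1)) (.seq (.op (.sub d d (d + 2)))
    (.seq B (.op (.copy (d + 1) (d + 2))))))

theorem countdown_exec {l : ℕ → ℕ} {d T : ℕ} {a : α} {B : Prog} {g : ℕ → ℕ → ℕ} (hd : 0 < d)
    (hl : ∀ j < Ctx.arity α, l j < d)
    (hB : ∀ (i acc : ℕ) (s : Store), s.Represents l a → s.reg d = i → s.reg (d + 1) = acc →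
      Computes B (d + 2) s (g i acc) T) (N : ℕ) :
    ∀ (acc : ℕ) (s : Store), s.Represents l a → s.reg d = N → s.reg (d + 1) = acc →
      ∃ t s', Exec (countdown d B) s t s' ∧ t ≤ N * (T + 4) + 1 ∧
        s'.reg (d + 1) = downFold g N acc ∧ (∀ r < d, s'.reg r = s.reg r) ∧ s'.arr = s.arr := by
  induction N with
  | zero =>
    intro acc s h hN hacc
    exact ⟨1, s, Exec.loop_stop hN, by omega, hacc, fun _ _ => rfl, rfl⟩
  | succ N ih =>
    intro acc s h hN hacc
    -- Register `d + 2` holds the constant `1` for the decrement; the loop body overwrites it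
    -- afterwards.
    set s₁ := (Instr.const (d + 2) 1).apply s with hs₁
    set s₂ := (Instr.sub d d (d + 2)).apply s₁ with hs₂
    have hr₂ : ∀ r < d, s₂.reg r = s.reg r := by
      intro r hr
      simp [hs₂, hs₁, Instr.apply, hr.ne, (show r ≠ d + 2 by omega)]
    have ha₂ : s₂.arr = s.arr := rfl
    have h₂ := h.congr hd hl hr₂ ha₂
    have hd₂ : s₂.reg d = N := by simp [hs₂, hs₁, Instr.apply, hN]
    have hd₂' : s₂.reg (d + 1) = acc := by simp [hs₂, hs₁, Instr.apply, hacc]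
    obtain ⟨t, s₃, he, ht, hv, hr, ha⟩ := hB N acc s₂ h₂ hd₂ hd₂'
    set s₄ := (Instr.copy (d + 1) (d + 2)).apply s₃ with hs₄
    have hr₄ : ∀ r < d, s₄.reg r = s.reg r := by
      intro r hrd
      rw [← hr₂ r hrd, ← hr r (by omega)]
      simp [hs₄, Instr.apply, (show r ≠ d + 1 by omega)]
    have ha₄ : s₄.arr = s.arr := ha
    have hd₄ : s₄.reg d = N := by
      rw [← hd₂, ← hr d (by omega)]
      simp [hs₄, Instr.apply]
    have hd₄' : s₄.reg (d + 1) = g N acc := by simp [hs₄, Instr.apply, hv]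
    obtain ⟨t', s₅, he', ht', hv', hr', ha'⟩ := ih _ s₄ (h.congr hd hl hr₄ ha₄) hd₄ hd₄'
    refine ⟨_, s₅, .loop_step (by omega)
      ((Exec.op _ _).seq ((Exec.op _ _).seq (he.seq (.op _ _)))) he', ?_, hv', ?_, ha'.trans ha₄⟩
    -- Each round costs `4` steps besides the body: the test, the constant, the subtraction and the
    -- copy.
    · rw [Nat.succ_mul]; omega
    · intro r hrd
      rw [hr' r hrd, hr₄ r hrd]

/-- A loop whose number `N a` of iterations need not be polynomial. -/
theorem fold_computes {N f : α → ℕ} {g : (α × ℕ) × ℕ → ℕ} (hN : PolyTime N) (hf : PolyTime f)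
    (hg : PolyTime g) :
    ∃ T : ℕ[X], ∀ (d : ℕ) (l : ℕ → ℕ), 0 < d → (∀ j < Ctx.arity α, l j < d) →
      ∃ P : Prog, ∀ (a : α) (s : Store), s.Represents l a →
        Computes P d s (downFold (fun i acc => g ((a, i), acc)) (N a) (f a))
          ((N a + 1) * T.eval (len a)) := by
  obtain ⟨R, hR⟩ := hN
  obtain ⟨T, hT⟩ := hf
  obtain ⟨U, hU⟩ := hg
  refine ⟨R + T + U + 6, fun d l hd hl => ?_⟩
  have hl' := pushLayout_lt hl
  obtain ⟨O, hO⟩ := hR d l hd hl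
  obtain ⟨P, hP⟩ := hT (d + 1) l d.succ_pos fun j hj => (hl j hj).trans d.lt_succ_self
  -- The body sees the counter in register `d` and the accumulator in register `d + 1`.
  obtain ⟨Q, hQ⟩ := hU (d + 2) (pushLayout (α × ℕ) (pushLayout α l d) (d + 1)) (by omega)
    (pushLayout_lt hl')
  refine ⟨.seq O (.seq P (.seq (countdown d Q) (.op (.copy d (d + 1))))), fun a s h => ?_⟩
  obtain ⟨t, s₁, he, ht, hv, hr, ha⟩ := hO a s h
  have h₁ := h.congr hd hl hr ha
  obtain ⟨t', s₂, he', ht', hv', hr', ha'⟩ := hP a s₁ h₁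
  have h₂ := h₁.congr hd hl (fun r hrd => hr' r (by omega)) ha'
  obtain ⟨t₃, s₃, he₃, ht₃, hv₃, hr₃, ha₃⟩ := countdown_exec (g := fun i acc => g ((a, i), acc))
    (T := U.eval (len a)) hd hl
    (fun i acc s hs hi hacc => hQ ((a, i), acc) s ((hs.push hi).push hacc)) (N a) (f a) s₂ h₂
    ((hr' d (by omega)).trans hv) hv'
  refine ⟨_, _, he.seq (he'.seq (he₃.seq (.op _ _))), ?_, ?_, ?_, ?_⟩
  · simp only [eval_add, eval_ofNat]
    nlinarith [Nat.zero_le (N a * R.eval (len a)), Nat.zero_le (N a * T.eval (len a))]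
  · simp [Instr.apply, hv₃]
  · intro r hrd
    simp [Instr.apply, hrd.ne, hr₃ r hrd, hr' r (by omega), hr r hrd]
  · simp [Instr.apply, ha₃, ha', ha]

/-- With one iteration per input bit, the bound of `fold_computes` is itself a polynomial. Sums and
bounded quantifiers reduce to this case. -/
theorem PolyTime.fold {f : α → ℕ} {g : (α × ℕ) × ℕ → ℕ} (hf : PolyTime f) (hg : PolyTime g) :
    PolyTime fun a => downFold (fun i acc => g ((a, i), acc)) (WellCovered.len a) (f a) := by
  obtain ⟨T, hT⟩ := fold_computes PolyTime.len hf hg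
  refine ⟨(X + 1) * T, fun d l hd hl => ?_⟩
  obtain ⟨P, hP⟩ := hT d l hd hl
  exact ⟨P, fun a s h => by simpa using hP a s h⟩

theorem downFold_add (g : ℕ → ℕ) (n acc : ℕ) :
    downFold (fun i acc => acc + g i) n acc = acc + ∑ i ∈ Finset.range n, g i := by
  induction n generalizing acc with
  | zero => simp [downFold]
  | succ n ih => rw [downFold, ih, Finset.sum_range_succ]; ring

theorem PolyTime.sum {f : α × ℕ → ℕ} (hf : PolyTime f) :
    PolyTime fun a => ∑ i ∈ Finset.range (WellCovered.len a), f (a, i) := by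
  refine ((PolyTime.const 0).fold (g := fun p => p.2 + f p.1) (PolyTime.snd.add hf.fst)).congr ?_
  intro a
  exact (downFold_add (fun i => f (a, i)) _ _).trans (zero_add _)

/-! #### Predicates -/

open Classical in
/-- The characteristic function of `p` is computed in polynomial time. -/
def PolyTimePred (p : α → Prop) : Prop :=
  PolyTime fun a => if p a then 1 else 0

theorem PolyTimePred.ite {p : α → Prop} [DecidablePred p] {f g : α → ℕ} (hp : PolyTimePred p)
    (hf : PolyTime f) (hg : PolyTime g) : PolyTime fun a => if p a then f a else g a := by
  refine (hp.ite_ne_zero hf hg).congr fun a => ?_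
  by_cases h : p a <;> simp [h]

theorem PolyTimePred.of_iff {p : α → Prop} {f : α → ℕ} (hf : PolyTime f)
    (h : ∀ a, f a ≠ 0 ↔ p a) : PolyTimePred p := by
  refine (hf.ite_ne_zero (.const 1) (.const 0)).congr fun a => ?_
  by_cases ha : p a
  · rw [if_pos ha, if_pos ((h a).2 ha)]
  · rw [if_neg ha, if_neg (mt (h a).1 ha)]

open Classical in
theorem PolyTimePred.not {p : α → Prop} (hp : PolyTimePred p) : PolyTimePred fun a => ¬ p a :=
  .of_iff (hp.ite (.const 0) (.const 1)) fun a => by by_cases h : p a <;> simp [h]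

open Classical in
theorem PolyTimePred.and {p q : α → Prop} (hp : PolyTimePred p) (hq : PolyTimePred q) :
    PolyTimePred fun a => p a ∧ q a :=
  .of_iff (hp.ite (hq.ite (.const 1) (.const 0)) (.const 0)) fun a => by
    by_cases h : p a <;> simp [h]

open Classical in
theorem PolyTimePred.or {p q : α → Prop} (hp : PolyTimePred p) (hq : PolyTimePred q) :
    PolyTimePred fun a => p a ∨ q a :=
  .of_iff (hp.ite (.const 1) (hq.ite (.const 1) (.const 0))) fun a => by
    by_cases h : p a <;> simp [h]

open Classical in
theorem PolyTimePred.imp {p q : α → Prop} (hp : PolyTimePred p) (hq : PolyTimePred q) :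
    PolyTimePred fun a => p a → q a :=
  .of_iff (hp.ite (hq.ite (.const 1) (.const 0)) (.const 1)) fun a => by
    by_cases h : p a <;> simp [h]

theorem PolyTimePred.iff {p q : α → Prop} (hp : PolyTimePred p) (hq : PolyTimePred q) :
    PolyTimePred fun a => (p a ↔ q a) := by
  simpa only [iff_def] using (hp.imp hq).and (hq.imp hp)

theorem PolyTimePred.lt {f g : α → ℕ} (hf : PolyTime f) (hg : PolyTime g) :
    PolyTimePred fun a => f a < g a :=
  .of_iff (hg.sub hf) fun a => by omega

theorem PolyTimePred.le {f g : α → ℕ} (hf : PolyTime f) (hg : PolyTime g) :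
    PolyTimePred fun a => f a ≤ g a := by
  simpa only [not_lt] using (PolyTimePred.lt hg hf).not

theorem PolyTimePred.eq {f g : α → ℕ} (hf : PolyTime f) (hg : PolyTime g) :
    PolyTimePred fun a => f a = g a := by
  simpa only [le_antisymm_iff] using (PolyTimePred.le hf hg).and (.le hg hf)

open Classical in
theorem PolyTimePred.exists {p : α × ℕ → Prop} (hp : PolyTimePred p) :
    PolyTimePred fun a => ∃ i < WellCovered.len a, p (a, i) :=
  .of_iff (PolyTime.sum (hp.ite (.const 1) (.const 0))) fun a => by simp

theorem PolyTimePred.forall {p : α × ℕ → Prop} (hp : PolyTimePred p) :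
    PolyTimePred fun a => ∀ i < WellCovered.len a, p (a, i) := by
  simpa using hp.not.exists.not

theorem PolyTimePred.fst {p : α → Prop} (hp : PolyTimePred p) :
    PolyTimePred fun q : α × ℕ => p q.1 :=
  PolyTime.fst hp

/-- No bound on `f a` is needed: array `0` holds `0` beyond the end of the word, where the lookup
gives `none`. -/
theorem PolyTimePred.bit {f : α → ℕ} (hf : PolyTime f) :
    PolyTimePred fun a => (Ctx.inp a)[f a]? = some true := by
  obtain ⟨T, hT⟩ := hf
  refine ⟨T + 1, fun d l hd hl => ?_⟩
  obtain ⟨P, hP⟩ := hT d l hd hl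
  refine ⟨.seq P (.op (.read d 0 d)), fun a s h => ?_⟩
  obtain ⟨t, s', he, ht, hv, hr, ha⟩ := hP a s h
  refine ⟨_, _, he.seq (.op _ _), by simpa using ht, ?_, ?_, ha⟩
  · simp [Instr.apply, hv, ha, h.bits]
  · intro r hrd
    simp [Instr.apply, hrd.ne, hr r hrd]

/-! #### Arithmetic -/

/-- The machine cannot multiply, so the product is a repeated addition. One factor is truncated
because the loop has only as many rounds as the input has bits. -/
theorem PolyTime.min_mul {f g : α → ℕ} (hf : PolyTime f) (hg : PolyTime g) :
    PolyTime fun a => min (f a) (WellCovered.len a) * g a := by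
  refine (PolyTime.sum (f := fun p => if p.2 < f p.1 then g p.1 else 0)
    ((PolyTimePred.lt .snd hf.fst).ite hg.fst (.const 0))).congr fun a => ?_
  dsimp only
  rw [← Finset.sum_filter, Finset.sum_const, smul_eq_mul]
  congr 1
  rw [← Finset.card_range (min (f a) (WellCovered.len a))]
  congr 1
  ext i
  simp [and_comm]

theorem downFold_double (k n acc : ℕ) :
    downFold (fun i acc => if i < k then acc + acc else acc) n acc = acc * 2 ^ min k n := by
  induction n generalizing acc with
  | zero => simp [downFold]
  | succ n ih =>
    rw [downFold, ih]
    split_ifs with h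
    · rw [min_eq_right (show n ≤ k by omega), min_eq_right (show n + 1 ≤ k by omega)]; ring
    · rw [min_eq_left (show k ≤ n by omega), min_eq_left (show k ≤ n + 1 by omega)]

theorem PolyTime.two_pow_min {f : α → ℕ} (hf : PolyTime f) :
    PolyTime fun a => 2 ^ min (f a) (WellCovered.len a) := by
  refine ((PolyTime.const 1).fold (g := fun p => if p.1.2 < f p.1.1 then p.2 + p.2 else p.2)
    ((PolyTimePred.lt PolyTime.snd.fst hf.fst.fst).ite (PolyTime.snd.add .snd) .snd)).congr
    fun a => ?_
  exact (downFold_double (f a) _ _).trans (one_mul _)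

/-- The `j`-th binary digit of `m`, provided that `m < 2 ^ L` and `j < L`. -/
def digit (L m j : ℕ) : Prop :=
  2 ^ min j L ≤ downFold (fun i r => if j < i ∧ 2 ^ min i L ≤ r then r - 2 ^ min i L else r) L m

theorem PolyTimePred.digit {f g : α → ℕ} (hf : PolyTime f) (hg : PolyTime g) :
    PolyTimePred fun a => digit (WellCovered.len a) (f a) (g a) :=
  .le hg.two_pow_min (hf.fold (g := fun p => if g p.1.1 < p.1.2 ∧
      2 ^ min p.1.2 (WellCovered.len p) ≤ p.2 then p.2 - 2 ^ min p.1.2 (WellCovered.len p) else p.2)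
    (((PolyTimePred.lt hg.fst.fst PolyTime.snd.fst).and
      (.le PolyTime.snd.fst.two_pow_min .snd)).ite
        (PolyTime.snd.sub PolyTime.snd.fst.two_pow_min) .snd))

/-- Greedily subtracting the powers `2 ^ i` with `i > j`, largest first, leaves `m % 2 ^ (j + 1)`.
This is at least `2 ^ j` exactly when digit `j` is `1`. -/
theorem digit_iff_testBit {L m j : ℕ} (hm : m < 2 ^ L) (hj : j < L) :
    digit L m j ↔ m.testBit j := by
  have key : ∀ n ≤ L, j < n → ∀ r, r < 2 ^ n →
      downFold (fun i r => if j < i ∧ 2 ^ min i L ≤ r then r - 2 ^ min i L else r) n r =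
        r % 2 ^ (j + 1) := by
    intro n
    induction n with
    | zero => intro _ h; omega
    | succ n ih =>
      intro hn hjn r hr
      rw [downFold, min_eq_left (show n ≤ L by omega)]
      rcases (Nat.lt_succ_iff.1 hjn).eq_or_lt with rfl | hlt
      -- The remaining indices are at most `j` and trigger no subtraction.
      · have : ∀ k ≤ j, ∀ r, downFold (fun i r => if j < i ∧ 2 ^ min i L ≤ r then
            r - 2 ^ min i L else r) k r = r := by
          intro k
          induction k with
          | zero => intro _ r; rfl
          | succ k ihk =>
            intro hk r
            rw [downFold, if_neg (by omega), ihk (by omega)]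
        rw [if_neg (by omega), this j le_rfl, Nat.mod_eq_of_lt hr]
      · rw [pow_succ] at hr
        split_ifs with h
        · rw [ih (by omega) hlt _ (by omega)]
          -- What is subtracted is a multiple of `2 ^ (j + 1)`, so the residue is unchanged.
          obtain ⟨c, hc⟩ : 2 ^ (j + 1) ∣ 2 ^ n := pow_dvd_pow 2 hlt
          rw [hc]
          rw [hc] at h
          conv_rhs => rw [← Nat.sub_add_cancel h.2]
          rw [Nat.add_mul_mod_self_left]
        · exact ih (by omega) hlt _ (by omega)
  rw [digit, key L le_rfl hj m hm, min_eq_left hj.le, Nat.mod_pow_succ,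
    Nat.testBit_eq_decide_div_mod_eq]
  have h1 : m % 2 ^ j < 2 ^ j := Nat.mod_lt _ (by positivity)
  rcases Nat.mod_two_eq_zero_or_one (m / 2 ^ j) with h | h <;> simp [h, h1]

/-! #### Decision procedures -/

/-- Fold a step over the numbers `N - 1, …, 0` and test the result. -/
theorem exists_prog_of_fold {N : List Bool × ℕ → ℕ} {g : ((List Bool × ℕ) × ℕ) × ℕ → ℕ}
    {h : (List Bool × ℕ) × ℕ → Prop} (hN : PolyTime N) (hg : PolyTime g) (hh : PolyTimePred h) :
    ∃ (P : Prog) (T : ℕ[X]), ∀ (x : List Bool) (k : ℕ), P.AnswersWithin x k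
      (h ((x, k), downFold (fun i acc => g (((x, k), i), acc)) (N (x, k)) 0))
      ((N (x, k) + 1) * T.eval x.length) := by
  obtain ⟨T, hT⟩ := fold_computes hN (.const 0) hg
  obtain ⟨U, hU⟩ := hh
  -- The only number of the context is `k`, which the initial memory holds in register `1`; scratch
  -- space begins at `2`.
  have hl : ∀ j < Ctx.arity (List Bool × ℕ), (fun _ => 1 : ℕ → ℕ) j < 2 := fun _ _ => by simp
  obtain ⟨P, hP⟩ := hT 2 (fun _ => 1) (by simp) hl
  obtain ⟨Q, hQ⟩ := hU 3 _ (by simp) (pushLayout_lt hl)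
  refine ⟨.seq P (.seq Q (.op (.copy 0 3))), T + U + 1, fun x k => ?_⟩
  have h₀ : (initStore x k).Represents (fun _ => 1) (x, k) :=
    { len := rfl
      bits := fun i => by simp [initStore, Ctx.inp]
      vals := fun j hj => by
        have : ¬ j < Ctx.arity (List Bool) := Nat.not_lt_zero j
        simp [initStore, Ctx.val, this] }
  obtain ⟨t, s, he, ht, hv, hr, ha⟩ := hP _ _ h₀
  obtain ⟨t', s', he', ht', hv', -, -⟩ :=
    hQ _ s ((h₀.congr (by simp) hl hr ha).push hv)
  refine ⟨_, _, he.seq (he'.seq (.op _ _)), ?_, ?_⟩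
  · simp only [len_prod] at ht ht'
    have : len x = x.length := rfl
    rw [this] at ht ht'
    simp only [eval_add, eval_one]
    nlinarith [Nat.zero_le (N (x, k) * U.eval x.length), Nat.zero_le (N (x, k))]
  · simp [Instr.apply, hv']

/-- The base is `L + 1` because the powers of a base at least `1` increase with the exponent, so
that exponents can be added up. -/
theorem exists_eval_le_pow (T : ℕ[X]) : ∃ K c : ℕ, ∀ L, T.eval L ≤ K * (L + 1) ^ c := by
  induction T using Polynomial.induction_on' with
  | add p q hp hq =>
    obtain ⟨K, c, h⟩ := hp
    obtain ⟨K', c', h'⟩ := hq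
    refine ⟨K + K', c + c', fun L => ?_⟩
    rw [eval_add, add_mul]
    have h1 : (L + 1) ^ c ≤ (L + 1) ^ (c + c') := Nat.pow_le_pow_right L.succ_pos (by omega)
    have h2 : (L + 1) ^ c' ≤ (L + 1) ^ (c + c') := Nat.pow_le_pow_right L.succ_pos (by omega)
    exact add_le_add ((h L).trans (Nat.mul_le_mul_left _ h1))
      ((h' L).trans (Nat.mul_le_mul_left _ h2))
  | monomial n a =>
    refine ⟨a, n, fun L => ?_⟩
    rw [eval_monomial]
    exact Nat.mul_le_mul_left _ (Nat.pow_le_pow_left L.le_succ n)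

end PolyTime

/-! ### Neighborhood partitions -/

section Graph

variable {V : Type*} {G : SimpleGraph V}

theorem maximal_isIndepSet_iff {S : Set V} :
    Maximal G.IsIndepSet S ↔
      (∀ u ∈ S, ∀ v ∈ S, ¬ G.Adj u v) ∧ ∀ u, u ∉ S → ∃ v ∈ S, G.Adj u v := by
  constructor
  · intro h
    have hS : ∀ u ∈ S, ∀ v ∈ S, ¬ G.Adj u v := fun u hu v hv huv => h.prop hu hv huv.ne huv
    refine ⟨hS, fun u hu => ?_⟩
    by_contra! hc
    refine hu (h.le_of_ge (y := insert u S) ?_ (Set.subset_insert u S) (Set.mem_insert u S))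
    rintro a (rfl | ha) b (rfl | hb) hab
    · exact absurd rfl hab
    · exact hc b hb
    · exact fun hadj => hc a ha hadj.symm
    · exact hS a ha b hb
  · rintro ⟨h1, h2⟩
    refine ⟨fun u hu v hv _ => h1 u hu v hv, fun T hT hST u hu => ?_⟩
    by_contra hc
    obtain ⟨v, hv, huv⟩ := h2 u hc
    exact hT hu (hST hv) huv.ne huv

/-- Every independent set of a finite graph extends to a maximal one, so equal sizes of the maximal
ones already make each of them maximum. -/
theorem isWellCovered_iff_card_eq [Fintype V] :
    IsWellCovered G ↔ ∀ S T : Finset V, Maximal G.IsIndepSet (S : Set V) →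
      Maximal G.IsIndepSet (T : Set V) → S.card = T.card := by
  classical
  constructor
  · intro h S T hS hT
    exact le_antisymm ((h T hT).maximum S hS.prop) ((h S hS).maximum T hT.prop)
  · intro h S hS
    refine ⟨hS.prop, fun T hT => ?_⟩
    obtain ⟨U, hTU, hU⟩ := Set.Finite.exists_le_maximal (s := {U : Set V | G.IsIndepSet U})
      (Set.toFinite _) hT
    have hU' : Maximal G.IsIndepSet ((U.toFinset : Finset V) : Set V) := by simpa using hU
    rw [h S _ hS hU']
    exact Finset.card_le_card (by rw [Set.subset_toFinset]; exact hTU)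

variable {t : ℕ} {p : V → Fin t}

namespace IsNeighborhoodPartition

theorem adj_congr_right (hp : IsNeighborhoodPartition G p) {v u u' : V} (h : G.Adj v u)
    (hu : p u = p u') (hv : u' ≠ v) : G.Adj v u' := by
  rcases hp.2 v (p u') with h' | h'
  · exact h' u' rfl hv
  · exact absurd h (h' u hu)

/-- The endpoints are moved one at a time; as they lie in different parts, the moved endpoint never
coincides with the fixed one. -/
theorem adj_congr (hp : IsNeighborhoodPartition G p) {u v u' v' : V} (h : G.Adj u v)
    (hu : p u = p u') (hv : p v = p v') (huv : p u ≠ p v) : G.Adj u' v' := by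
  have h1 := hp.adj_congr_right h hv fun e => huv (by rw [hv, e])
  exact (hp.adj_congr_right h1.symm hu fun e => huv (by rw [hu, hv, e])).symm

/-- A single edge inside a part can be moved, one endpoint at a time, to any pair of distinct
vertices of the part. -/
theorem isClique_of_adj (hp : IsNeighborhoodPartition G p) {u v : V} (h : G.Adj u v)
    (huv : p u = p v) : G.IsClique (p ⁻¹' {p u}) := by
  intro a ha b hb hab
  replace ha : p a = p u := ha
  replace hb : p b = p u := hb
  by_cases hbu : b = u
  · subst hbu
    exact (hp.adj_congr_right h (huv.symm.trans ha.symm) hab).symm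
  · have h1 : G.Adj u b := hp.adj_congr_right h (huv.symm.trans hb.symm) hbu
    exact (hp.adj_congr_right h1.symm ha.symm hab).symm

/-- The image of a maximal independent set in the contracted graph. -/
theorem maximal_image (hp : IsNeighborhoodPartition G p) {T : Set V}
    (hT : Maximal G.IsIndepSet T) : Maximal (quotientGraph G p).IsIndepSet (p '' T) := by
  rw [maximal_isIndepSet_iff] at hT ⊢
  refine ⟨?_, fun j hj => ?_⟩
  · rintro _ ⟨u, hu, rfl⟩ _ ⟨v, hv, rfl⟩ ⟨hne, u', v', hu', hv', h⟩
    exact hT.1 u hu v hv (hp.adj_congr h hu' hv' (by rwa [hu', hv']))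
  · obtain ⟨u, rfl⟩ := hp.1 j
    obtain ⟨v, hv, huv⟩ := hT.2 u fun hu => hj ⟨u, hu, rfl⟩
    exact ⟨p v, ⟨v, hv, rfl⟩, fun e => hj ⟨v, hv, e.symm⟩, u, v, rfl, rfl, huv⟩

open Classical in
-- Part by part: `T` has one vertex in a clique that it meets, and contains every other part that it
-- meets.
theorem sum_partWeight_image [Fintype V] (hp : IsNeighborhoodPartition G p) {T : Finset V}
    (hT : Maximal G.IsIndepSet (T : Set V)) :
    ∑ i ∈ T.image p, partWeight G p i = T.card := by
  rw [maximal_isIndepSet_iff] at hT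
  rw [Finset.card_eq_sum_card_image p T]
  refine Finset.sum_congr rfl fun i hi => ?_
  obtain ⟨v, hv, rfl⟩ := Finset.mem_image.1 hi
  unfold partWeight
  split_ifs with hc
  · refine (Finset.card_eq_one.2 ⟨v, ?_⟩).symm
    ext u
    simp only [Finset.mem_filter, Finset.mem_singleton]
    refine ⟨fun ⟨hu, huv⟩ => ?_, fun h => by rw [h]; exact ⟨hv, rfl⟩⟩
    by_contra hne
    exact hT.1 u hu v hv (hc huv rfl hne)
  · rw [Set.ncard_eq_toFinset_card']
    congr 1
    ext u
    simp only [Set.mem_toFinset, Set.mem_preimage, Set.mem_singleton_iff, Finset.mem_filter]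
    refine ⟨fun hu => ⟨?_, hu⟩, fun h => h.2⟩
    by_contra hne
    -- A neighbor `w` of the missing vertex `u` in the same part would make the part a clique; in
    -- another part it would be adjacent to `v` as well, although both lie in `T`.
    obtain ⟨w, hw, huw⟩ := hT.2 u hne
    by_cases e : p u = p w
    · exact hc (hu ▸ hp.isClique_of_adj huw e)
    · exact hT.1 v hv w hw (hp.adj_congr huw hu rfl e)

end IsNeighborhoodPartition

/-- The union of the parts with index in `S`, where a part `V_j` that is a clique is replaced by
its element `r j`. -/
def liftSet (G : SimpleGraph V) (p : V → Fin t) (r : Fin t → V) (S : Set (Fin t)) : Set V :=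
  {u | p u ∈ S ∧ (G.IsClique (p ⁻¹' {p u}) → u = r (p u))}

theorem image_liftSet {r : Fin t → V} (hr : ∀ j, p (r j) = j) (S : Set (Fin t)) :
    p '' liftSet G p r S = S := by
  ext j
  constructor
  · rintro ⟨u, hu, rfl⟩
    exact hu.1
  · intro hj
    exact ⟨r j, ⟨by rwa [hr], fun _ => by rw [hr]⟩, hr j⟩

theorem IsNeighborhoodPartition.maximal_liftSet (hp : IsNeighborhoodPartition G p)
    {r : Fin t → V} (hr : ∀ j, p (r j) = j) {S : Set (Fin t)}
    (hS : Maximal (quotientGraph G p).IsIndepSet S) :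
    Maximal G.IsIndepSet (liftSet G p r S) := by
  rw [maximal_isIndepSet_iff] at hS ⊢
  have hmem : ∀ j ∈ S, r j ∈ liftSet G p r S := fun j hj =>
    ⟨by rwa [hr], fun _ => by rw [hr]⟩
  refine ⟨fun u hu v hv huv => ?_, fun u hu => ?_⟩
  · by_cases e : p u = p v
    · have hc := hp.isClique_of_adj huv e
      refine huv.ne ((hu.2 hc).trans ?_)
      rw [e] at hc ⊢
      exact (hv.2 hc).symm
    · exact hS.1 _ hu.1 _ hv.1 ⟨e, u, v, rfl, rfl, huv⟩
  · by_cases hpu : p u ∈ S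
    · have : ¬ (G.IsClique (p ⁻¹' {p u}) → u = r (p u)) := fun h => hu ⟨hpu, h⟩
      push Not at this
      exact ⟨r (p u), hmem _ hpu, this.1 rfl (hr _) this.2⟩
    · obtain ⟨j, hj, hne, u', v', hu', hv', h⟩ := hS.2 _ hpu
      exact ⟨r j, hmem j hj, hp.adj_congr h hu' (by rw [hv', hr]) (by rwa [hu', hv'])⟩

theorem isWellCovered_iff_quotient [Fintype V] (hp : IsNeighborhoodPartition G p) :
    IsWellCovered G ↔ ∀ S T : Finset (Fin t),
      Maximal (quotientGraph G p).IsIndepSet (S : Set (Fin t)) →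
      Maximal (quotientGraph G p).IsIndepSet (T : Set (Fin t)) →
      ∑ i ∈ S, partWeight G p i = ∑ i ∈ T, partWeight G p i := by
  classical
  rw [isWellCovered_iff_card_eq]
  constructor
  · intro h
    choose r hr using hp.1
    have key : ∀ S : Finset (Fin t), Maximal (quotientGraph G p).IsIndepSet (S : Set (Fin t)) →
        ∃ U : Finset V, Maximal G.IsIndepSet (U : Set V) ∧
          ∑ i ∈ S, partWeight G p i = U.card := by
      intro S hS
      have hU : Maximal G.IsIndepSet (((liftSet G p r S).toFinset : Finset V) : Set V) := by
        simpa using hp.maximal_liftSet hr hS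
      refine ⟨_, hU, ?_⟩
      rw [← hp.sum_partWeight_image hU]
      congr 1
      rw [← Finset.coe_inj, Finset.coe_image, Set.coe_toFinset, image_liftSet hr]
    intro S T hS hT
    obtain ⟨U, hU, hSU⟩ := key S hS
    obtain ⟨W, hW, hTW⟩ := key T hT
    rw [hSU, hTW, h U W hU hW]
  · intro h S T hS hT
    rw [← hp.sum_partWeight_image hS, ← hp.sum_partWeight_image hT]
    refine h _ _ ?_ ?_ <;> rw [Finset.coe_image]
    exacts [hp.maximal_image hS, hp.maximal_image hT]

/-! ### Twins -/

/-- Every vertex other than `u` and `v` has the same adjacency to `u` as to `v`. -/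
def Twin (G : SimpleGraph V) (u v : V) : Prop :=
  ∀ w, w ≠ u → w ≠ v → (G.Adj w u ↔ G.Adj w v)

theorem Twin.refl (u : V) : Twin G u u := fun _ _ _ => Iff.rfl

theorem Twin.symm {u v : V} (h : Twin G u v) : Twin G v u := fun w hu hv => (h w hv hu).symm

theorem Twin.trans {u v w : V} (h : Twin G u v) (h' : Twin G v w) : Twin G u w := by
  intro x hu hw
  by_cases hv : x = v
  · subst hv
    -- The test vertex is now the middle vertex, which the hypotheses do not cover directly; the
    -- adjacency is passed through the edge between `u` and `w`.
    by_cases huw : u = w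
    · rw [huw]
    · rw [G.adj_comm x u, h' u hu.symm huw, G.adj_comm u w, h w (Ne.symm huw) hw.symm,
        G.adj_comm]
  · exact (h x hu hv).trans (h' x hv hw)

theorem IsNeighborhoodPartition.twin (hp : IsNeighborhoodPartition G p) {u v : V}
    (h : p u = p v) : Twin G u v := fun _ hu hv =>
  ⟨fun ha => hp.adj_congr_right ha h hv.symm, fun ha => hp.adj_congr_right ha h.symm hu.symm⟩

theorem isNeighborhoodPartition_of_twin (hs : Function.Surjective p)
    (h : ∀ u v, p u = p v → Twin G u v) : IsNeighborhoodPartition G p := by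
  refine ⟨hs, fun v i => ?_⟩
  by_cases hu : ∃ u, p u = i ∧ G.Adj v u
  · obtain ⟨u, rfl, hadj⟩ := hu
    exact .inl fun u' hu' hne => (h u u' hu'.symm v hadj.ne hne.symm).1 hadj
  · push Not at hu
    exact .inr hu

end Graph

/-! ### Representatives of the twin classes -/

section Twins

variable {n : ℕ} (G : SimpleGraph (Fin n))

/-- `v` is the first vertex of its twin class. -/
def IsRep (v : Fin n) : Prop := ∀ u < v, ¬ Twin G u v

open Classical in
/-- The number of twin classes. -/
noncomputable def numReps : ℕ := (Finset.univ.filter fun v => IsRep G v).card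

open Classical in
/-- The number of twin classes that start before the twin class of `u` does. -/
noncomputable def classIndex (u : Fin n) : ℕ :=
  (Finset.univ.filter fun v => IsRep G v ∧ ∀ w ≤ v, ¬ Twin G w u).card

variable {G}

theorem exists_isRep (u : Fin n) : ∃ r, IsRep G r ∧ Twin G r u := by
  classical
  obtain ⟨r, hr, hmin⟩ := Finset.exists_min_image (Finset.univ.filter fun w => Twin G w u) id
    ⟨u, by simpa using Twin.refl u⟩
  simp only [Finset.mem_filter, Finset.mem_univ, true_and, id] at hr hmin
  exact ⟨r, fun w hw hwr => (hmin w (hwr.trans hr)).not_gt hw, hr⟩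

theorem IsRep.eq {r r' : Fin n} (h : IsRep G r) (h' : IsRep G r') (ht : Twin G r r') : r = r' := by
  rcases lt_trichotomy r r' with hlt | rfl | hlt
  · exact absurd ht (h' r hlt)
  · rfl
  · exact absurd ht.symm (h r' hlt)

open Classical in
-- Having no twin of `u` up to `v` means that `v` comes before `r`, the first twin of `u`.
theorem classIndex_eq {r u : Fin n} (hr : IsRep G r) (h : Twin G r u) :
    classIndex G u = (Finset.univ.filter fun v => IsRep G v ∧ v < r).card := by
  unfold classIndex
  congr 1
  ext v
  simp only [Finset.mem_filter, Finset.mem_univ, true_and]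
  refine and_congr_right fun _ => ⟨fun hv => ?_, fun hv w hw hwu => ?_⟩
  · by_contra hlt
    exact hv r (not_lt.1 hlt) h
  · exact hr w (hw.trans_lt hv) (hwu.trans h.symm)

theorem classIndex_lt_classIndex {r r' u u' : Fin n} (hr : IsRep G r) (h : Twin G r u)
    (hr' : IsRep G r') (h' : Twin G r' u') (hlt : r < r') : classIndex G u < classIndex G u' := by
  classical
  rw [classIndex_eq hr h, classIndex_eq hr' h']
  refine Finset.card_lt_card (Finset.ssubset_iff_of_subset ?_ |>.2 ⟨r, ?_, ?_⟩)
  · intro v hv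
    simp only [Finset.mem_filter, Finset.mem_univ, true_and] at hv ⊢
    exact ⟨hv.1, hv.2.trans hlt⟩
  · simpa using ⟨hr, hlt⟩
  · simp

theorem classIndex_eq_iff {u v : Fin n} : classIndex G u = classIndex G v ↔ Twin G u v := by
  obtain ⟨r, hr, h⟩ := exists_isRep (G := G) u
  obtain ⟨r', hr', h'⟩ := exists_isRep (G := G) v
  constructor
  · intro e
    rcases lt_trichotomy r r' with hlt | rfl | hlt
    · exact absurd e (classIndex_lt_classIndex hr h hr' h' hlt).ne
    · exact h.symm.trans h'
    · exact absurd e (classIndex_lt_classIndex hr' h' hr h hlt).ne'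
  · intro ht
    rw [classIndex_eq hr h, classIndex_eq hr (h.trans ht)]

theorem classIndex_lt (u : Fin n) : classIndex G u < numReps G := by
  classical
  obtain ⟨r, hr, h⟩ := exists_isRep (G := G) u
  rw [classIndex_eq hr h]
  refine Finset.card_lt_card (Finset.ssubset_iff_of_subset ?_ |>.2 ⟨r, by simpa using hr, by simp⟩)
  intro v hv
  simp only [Finset.mem_filter, Finset.mem_univ, true_and] at hv ⊢
  exact hv.1

variable (G) in
/-- The partition into twin classes. -/
noncomputable def twinPartition (u : Fin n) : Fin (numReps G) := ⟨classIndex G u, classIndex_lt u⟩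

theorem twinPartition_eq_iff {u v : Fin n} :
    twinPartition G u = twinPartition G v ↔ Twin G u v := by
  rw [twinPartition, twinPartition, Fin.mk.injEq, classIndex_eq_iff]

/-- Distinct representatives have distinct indices, and there are as many representatives as
indices. -/
theorem exists_isRep_twinPartition (j : Fin (numReps G)) :
    ∃ r, IsRep G r ∧ twinPartition G r = j := by
  classical
  have hb : Function.Bijective fun r : {v // IsRep G v} => twinPartition G r.1 := by
    rw [Fintype.bijective_iff_injective_and_card]
    refine ⟨fun r r' h => Subtype.ext (r.2.eq r'.2 (twinPartition_eq_iff.1 h)), ?_⟩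
    rw [Fintype.card_fin, numReps, Fintype.card_subtype]
  obtain ⟨r, hr⟩ := hb.2 j
  exact ⟨r.1, r.2, hr⟩

variable (G) in
theorem isNeighborhoodPartition_twinPartition : IsNeighborhoodPartition G (twinPartition G) :=
  isNeighborhoodPartition_of_twin
    (fun j => let ⟨r, _, h⟩ := exists_isRep_twinPartition j; ⟨r, h⟩)
    fun _ _ h => twinPartition_eq_iff.1 h

variable (G) in
-- Distinct representatives are not twins, so any neighborhood partition puts them in different
-- parts.
theorem neighborhoodDiversity_eq : neighborhoodDiversity G = numReps G := by
  classical
  refine le_antisymm (Nat.sInf_le ⟨_, isNeighborhoodPartition_twinPartition G⟩) ?_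
  refine le_csInf ⟨_, _, isNeighborhoodPartition_twinPartition G⟩ ?_
  rintro t ⟨p, hp⟩
  have hinj : Function.Injective fun r : {v // IsRep G v} => p r.1 := fun r r' h =>
    Subtype.ext (r.2.eq r'.2 (hp.twin h))
  simpa [numReps, Fintype.card_subtype] using Fintype.card_le_of_injective _ hinj

variable (G) in
theorem numReps_le : numReps G ≤ n := by
  classical
  simpa [numReps] using Finset.card_filter_le (Finset.univ : Finset (Fin n)) fun v => IsRep G v

/-! ### Candidate sets indexed by binary numbers -/

variable (G) in
/-- The candidate set with index `m`: the twin classes given by the binary digits of `m`, where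
cliques are replaced by their first vertices. -/
def candidate (m : ℕ) : Set (Fin n) :=
  {u | m.testBit (classIndex G u) ∧ (IsRep G u ∨ ∃ v, Twin G u v ∧ v ≠ u ∧ ¬ G.Adj u v)}

/-- Whether the class of `u` is a clique can be tested at `u` alone: one edge from `u` to a twin
settles it, and a singleton is a clique. -/
theorem candidate_eq_liftSet {r : Fin (numReps G) → Fin n} (hr : ∀ j, IsRep G (r j))
    (hr' : ∀ j, twinPartition G (r j) = j) (m : ℕ) :
    candidate G m = liftSet G (twinPartition G) r {j | m.testBit j} := by
  have hp := isNeighborhoodPartition_twinPartition G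
  ext u
  refine and_congr Iff.rfl ?_
  have hru : IsRep G u ↔ u = r (twinPartition G u) := by
    refine ⟨fun h => h.eq (hr _) (twinPartition_eq_iff.1 (hr' _).symm), fun h => ?_⟩
    rw [h]
    exact hr _
  rw [hru, or_comm, or_iff_not_imp_left]
  refine imp_congr_left ?_
  push Not
  constructor
  · intro h
    by_cases hv : ∃ v, Twin G u v ∧ v ≠ u
    · obtain ⟨v, hv, hne⟩ := hv
      exact hp.isClique_of_adj (h v hv hne) (twinPartition_eq_iff.2 hv)
    · push Not at hv
      intro a ha b hb hab
      rw [hv a (twinPartition_eq_iff.1 (Eq.symm ha)),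
        hv b (twinPartition_eq_iff.1 (Eq.symm hb))] at hab
      exact absurd rfl hab
  · intro h v hv hne
    exact h (Set.mem_preimage.2 rfl) (twinPartition_eq_iff.2 hv.symm) hne.symm

theorem exists_testBit_iff {t : ℕ} (S : Set (Fin t)) :
    ∃ m < 2 ^ t, ∀ j : Fin t, m.testBit j ↔ j ∈ S := by
  classical
  refine ⟨Nat.ofBits fun j => decide (j ∈ S), Nat.ofBits_lt_two_pow _, fun j => ?_⟩
  rw [Nat.testBit_ofBits_lt _ _ j.2]
  simp

variable (G) in
-- Each maximal independent set of the contracted graph lifts to a candidate whose size is its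
-- weight. Maximality is tested in `G` itself, so the algorithm need not build the contracted graph.
theorem isWellCovered_iff_candidate :
    IsWellCovered G ↔ ∀ m < 2 ^ numReps G, ∀ m' < 2 ^ numReps G,
      Maximal G.IsIndepSet (candidate G m) → Maximal G.IsIndepSet (candidate G m') →
        (candidate G m).ncard = (candidate G m').ncard := by
  classical
  have hp := isNeighborhoodPartition_twinPartition G
  constructor
  · intro h m _ m' _ hm hm'
    rw [Set.ncard_eq_toFinset_card', Set.ncard_eq_toFinset_card']
    exact isWellCovered_iff_card_eq.1 h _ _ (by simpa using hm) (by simpa using hm')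
  · intro h
    choose r hr hr' using exists_isRep_twinPartition (G := G)
    have key : ∀ S : Finset (Fin (numReps G)),
        Maximal (quotientGraph G (twinPartition G)).IsIndepSet (S : Set (Fin (numReps G))) →
        ∃ m < 2 ^ numReps G, Maximal G.IsIndepSet (candidate G m) ∧
          ∑ i ∈ S, partWeight G (twinPartition G) i = (candidate G m).ncard := by
      intro S hS
      obtain ⟨m, hm, hmS⟩ := exists_testBit_iff (S : Set (Fin (numReps G)))
      have hc : candidate G m = liftSet G (twinPartition G) r S := by
        rw [candidate_eq_liftSet hr hr']
        congr 1
        ext j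
        exact hmS j
      have hmax := hp.maximal_liftSet hr' hS
      have hU : Maximal G.IsIndepSet
          (((liftSet G (twinPartition G) r S).toFinset : Finset (Fin n)) : Set (Fin n)) := by
        simpa using hmax
      refine ⟨m, hm, by rwa [hc], ?_⟩
      rw [hc, Set.ncard_eq_toFinset_card', ← hp.sum_partWeight_image hU]
      congr 1
      rw [← Finset.coe_inj, Finset.coe_image, Set.coe_toFinset, image_liftSet hr']
    rw [isWellCovered_iff_quotient hp]
    intro S T hS hT
    obtain ⟨m, hm, hmax, hw⟩ := key S hS
    obtain ⟨m', hm', hmax', hw'⟩ := key T hT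
    rw [hw, hw', h m hm m' hm' hmax hmax']

end Twins

/-! ### The algorithm, as functions of the input word -/

section Word

open Classical

variable (x : List Bool)

/-- The number `n` of vertices, determined from the length `n + 1 + n * n` of the code. -/
noncomputable def order : ℕ :=
  ∑ i ∈ Finset.range x.length, if i + 1 + min i x.length * i < x.length then 1 else 0

/-- The entries of the adjacency matrix. -/
def wordAdj (u v : ℕ) : Prop :=
  x[order x + 1 + (min u x.length * order x + v)]? = some true

/-- Here and below, quantifiers range over numbers below the word length, to fit
`PolyTimePred.forall` and `PolyTimePred.exists`; comparisons with `order x` or with a given vertex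
restrict them further. -/
def wordTwin (u v : ℕ) : Prop :=
  ∀ w < x.length, w < order x → w ≠ u → w ≠ v → (wordAdj x w u ↔ wordAdj x w v)

def wordIsRep (v : ℕ) : Prop := ∀ u < x.length, u < v → ¬ wordTwin x u v

noncomputable def wordNumReps : ℕ :=
  ∑ v ∈ Finset.range x.length, if v < order x ∧ wordIsRep x v then 1 else 0

noncomputable def wordClassIndex (u : ℕ) : ℕ :=
  ∑ v ∈ Finset.range x.length,
    if v < order x ∧ wordIsRep x v ∧ ∀ w < x.length, w ≤ v → ¬ wordTwin x w u then 1 else 0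

def wordCandidate (m u : ℕ) : Prop :=
  u < order x ∧ digit x.length m (wordClassIndex x u) ∧ (wordIsRep x u ∨
    ∃ v < x.length, v < order x ∧ wordTwin x u v ∧ v ≠ u ∧ ¬ wordAdj x u v)

def wordIsMaximal (m : ℕ) : Prop :=
  (∀ u < x.length, wordCandidate x m u →
    ∀ v < x.length, wordCandidate x m v → ¬ wordAdj x u v) ∧
  ∀ u < x.length, u < order x → ¬ wordCandidate x m u →
    ∃ v < x.length, wordCandidate x m v ∧ wordAdj x u v

noncomputable def wordCard (m : ℕ) : ℕ :=
  ∑ u ∈ Finset.range x.length, if wordCandidate x m u then 1 else 0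

/-- One step of the main loop: `0` means that no maximal independent set was found so far, `w + 2`
that all those that were found have size `w`, and `1` that two sizes were found. -/
noncomputable def wordStep (m acc : ℕ) : ℕ :=
  if wordIsMaximal x m then
    if acc = 0 then wordCard x m + 2 else if acc = wordCard x m + 2 then acc else 1
  else acc

/-- The word encodes a nonempty graph. -/
def wordIsGraph : Prop :=
  1 ≤ order x ∧ x.length = order x + 1 + min (order x) x.length * order x ∧
    (∀ i < x.length, i < order x → x[i]? = some true) ∧ ¬ x[order x]? = some true ∧
    ∀ u < x.length, u < order x → ∀ v < x.length, v < order x → wordAdj x u v →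
      wordAdj x v u ∧ u ≠ v

/-! ### Polynomial time bounds for the ingredients of the algorithm -/

variable {x}

variable {α : Type} [Ctx α]

theorem polyTime_order : PolyTime fun a : α => order (Ctx.inp a) :=
  PolyTime.sum (f := fun p : α × ℕ => if p.2 + 1 + min p.2 (len p) * p.2 < len p then 1 else 0)
    ((PolyTimePred.lt ((PolyTime.snd.add (.const 1)).add (PolyTime.snd.min_mul .snd))
      PolyTime.len).ite (.const 1) (.const 0))

theorem polyTimePred_wordAdj {f g : α → ℕ} (hf : PolyTime f) (hg : PolyTime g) :
    PolyTimePred fun a => wordAdj (Ctx.inp a) (f a) (g a) :=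
  .bit ((polyTime_order.add (.const 1)).add ((hf.min_mul polyTime_order).add hg))

theorem polyTimePred_wordTwin {f g : α → ℕ} (hf : PolyTime f) (hg : PolyTime g) :
    PolyTimePred fun a => wordTwin (Ctx.inp a) (f a) (g a) :=
  .forall ((PolyTimePred.lt .snd polyTime_order).imp ((PolyTimePred.eq .snd hf.fst).not.imp
    ((PolyTimePred.eq .snd hg.fst).not.imp
      ((polyTimePred_wordAdj .snd hf.fst).iff (polyTimePred_wordAdj .snd hg.fst)))))

theorem polyTimePred_wordIsRep {f : α → ℕ} (hf : PolyTime f) :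
    PolyTimePred fun a => wordIsRep (Ctx.inp a) (f a) :=
  .forall ((PolyTimePred.lt .snd hf.fst).imp (polyTimePred_wordTwin .snd hf.fst).not)

theorem polyTime_wordNumReps : PolyTime fun a : α => wordNumReps (Ctx.inp a) :=
  PolyTime.sum (((PolyTimePred.lt .snd polyTime_order).and (polyTimePred_wordIsRep .snd)).ite
    (.const 1) (.const 0))

theorem polyTime_wordClassIndex {f : α → ℕ} (hf : PolyTime f) :
    PolyTime fun a => wordClassIndex (Ctx.inp a) (f a) :=
  PolyTime.sum (((PolyTimePred.lt .snd polyTime_order).and ((polyTimePred_wordIsRep .snd).and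
    (.forall ((PolyTimePred.le .snd PolyTime.snd.fst).imp
      (polyTimePred_wordTwin .snd hf.fst.fst).not)))).ite (.const 1) (.const 0))

theorem polyTimePred_wordCandidate {f g : α → ℕ} (hf : PolyTime f) (hg : PolyTime g) :
    PolyTimePred fun a => wordCandidate (Ctx.inp a) (f a) (g a) :=
  (PolyTimePred.lt hg polyTime_order).and ((PolyTimePred.digit hf (polyTime_wordClassIndex hg)).and
    ((polyTimePred_wordIsRep hg).or (.exists ((PolyTimePred.lt .snd polyTime_order).and
      ((polyTimePred_wordTwin hg.fst .snd).and ((PolyTimePred.eq .snd hg.fst).not.and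
        (polyTimePred_wordAdj hg.fst .snd).not))))))

theorem polyTimePred_wordIsMaximal {f : α → ℕ} (hf : PolyTime f) :
    PolyTimePred fun a => wordIsMaximal (Ctx.inp a) (f a) :=
  .and (.forall ((polyTimePred_wordCandidate hf.fst .snd).imp
      (.forall ((polyTimePred_wordCandidate hf.fst.fst .snd).imp
        (polyTimePred_wordAdj PolyTime.snd.fst .snd).not))))
    (.forall ((PolyTimePred.lt .snd polyTime_order).imp
      ((polyTimePred_wordCandidate hf.fst .snd).not.imp
        (.exists ((polyTimePred_wordCandidate hf.fst.fst .snd).and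
          (polyTimePred_wordAdj PolyTime.snd.fst .snd))))))

theorem polyTime_wordCard {f : α → ℕ} (hf : PolyTime f) :
    PolyTime fun a => wordCard (Ctx.inp a) (f a) :=
  PolyTime.sum ((polyTimePred_wordCandidate hf.fst .snd).ite (.const 1) (.const 0))

theorem polyTime_wordStep {f g : α → ℕ} (hf : PolyTime f) (hg : PolyTime g) :
    PolyTime fun a => wordStep (Ctx.inp a) (f a) (g a) :=
  (polyTimePred_wordIsMaximal hf).ite ((PolyTimePred.eq hg (.const 0)).ite
    ((polyTime_wordCard hf).add (.const 2))
    ((PolyTimePred.eq hg ((polyTime_wordCard hf).add (.const 2))).ite hg (.const 1))) hg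

theorem polyTimePred_wordIsGraph : PolyTimePred fun a : α => wordIsGraph (Ctx.inp a) :=
  .and (.le (.const 1) polyTime_order) (.and
    (.eq PolyTime.len ((polyTime_order.add (.const 1)).add (polyTime_order.min_mul polyTime_order)))
    (.and (.forall ((PolyTimePred.lt .snd polyTime_order).imp (.bit .snd)))
      (.and (PolyTimePred.bit polyTime_order).not
        (.forall ((PolyTimePred.lt .snd polyTime_order).imp
          (.forall ((PolyTimePred.lt .snd polyTime_order).imp
            ((polyTimePred_wordAdj PolyTime.snd.fst .snd).imp
              ((polyTimePred_wordAdj .snd PolyTime.snd.fst).and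
                (PolyTimePred.eq PolyTime.snd.fst .snd).not)))))))))

/-- The outcome of the main loop over `N` candidates. -/
theorem downFold_wordStep_eq_one_iff (N : ℕ) :
    downFold (wordStep x) N 0 ≠ 1 ↔ ∀ m < N, ∀ m' < N, wordIsMaximal x m → wordIsMaximal x m' →
      wordCard x m = wordCard x m' := by
  -- State `1` is absorbing, since it is neither `0` nor of the form `w + 2`.
  have one : ∀ N, downFold (wordStep x) N 1 = 1 := by
    intro N
    induction N with
    | zero => rfl
    | succ N ih =>
      rw [downFold, show wordStep x N 1 = 1 by simp [wordStep]]
      exact ih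
  have add_two : ∀ N w, downFold (wordStep x) N (w + 2) ≠ 1 ↔
      ∀ m < N, wordIsMaximal x m → wordCard x m = w := by
    intro N w
    induction N with
    | zero => simp [downFold]
    | succ N ih =>
      rw [downFold, Nat.forall_lt_succ_right, ← ih]
      by_cases hm : wordIsMaximal x N
      · by_cases hw : wordCard x N = w
        · rw [show wordStep x N (w + 2) = w + 2 by simp [wordStep, hm, hw]]
          simp [hw]
        · rw [show wordStep x N (w + 2) = 1 by simp [wordStep, hm, Ne.symm hw], one]
          simp [hm, hw]
      · rw [show wordStep x N (w + 2) = w + 2 by simp [wordStep, hm]]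
        simp [hm]
  induction N with
  | zero => simp [downFold]
  | succ N ih =>
    rw [downFold]
    by_cases hm : wordIsMaximal x N
    · rw [show wordStep x N 0 = wordCard x N + 2 by simp [wordStep, hm], add_two]
      constructor
      · intro h
        have h' : ∀ m < N + 1, wordIsMaximal x m → wordCard x m = wordCard x N := by
          rw [Nat.forall_lt_succ_right]
          exact ⟨h, fun _ => rfl⟩
        intro m hmN m' hmN' h1 h2
        rw [h' m hmN h1, h' m' hmN' h2]
      · intro h m hmN h1
        exact h m (by omega) N (by omega) h1 hm
    · rw [show wordStep x N 0 = 0 by simp [wordStep, hm]]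
      refine ih.trans ?_
      constructor
      · intro h m hmN m' hmN' h1 h2
        refine h m ?_ m' ?_ h1 h2
        · exact lt_of_le_of_ne (Nat.lt_succ_iff.1 hmN) fun e => hm (e ▸ h1)
        · exact lt_of_le_of_ne (Nat.lt_succ_iff.1 hmN') fun e => hm (e ▸ h2)
      · intro h m hmN m' hmN'
        exact h m (by omega) m' (by omega)

end Word

/-! ### The algorithm on the code of a graph -/

section Encode

open Classical

/-- The function `i + 1 + i * i` is strictly increasing, so exactly the `n` numbers `i < n` are
counted. -/
theorem order_eq {x : List Bool} {n : ℕ} (h : x.length = n + 1 + n * n) : order x = n := by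
  have : ∀ i ∈ Finset.range x.length,
      (if i + 1 + min i x.length * i < x.length then 1 else 0) = if i < n then 1 else 0 := by
    intro i hi
    rw [min_eq_left (Finset.mem_range.1 hi).le, h]
    refine if_congr ⟨fun hlt => ?_, fun hlt => ?_⟩ rfl rfl
    · by_contra hn
      nlinarith
    · nlinarith
  rw [order, Finset.sum_congr rfl this, ← Finset.sum_filter, ← Finset.card_eq_sum_ones]
  have : (Finset.range x.length).filter (· < n) = Finset.range n := by
    ext i
    simp only [Finset.mem_filter, Finset.mem_range]
    constructor
    · exact fun h => h.2
    · intro hi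
      exact ⟨by rw [h]; omega, hi⟩
  rw [this, Finset.card_range]

variable {n : ℕ} (G : SimpleGraph (Fin n))

theorem length_encodeGraph : (encodeGraph G).length = n + 1 + n * n := by
  simp only [encodeGraph, List.length_append, List.length_replicate, List.length_cons,
    List.length_ofFn]
  ring

theorem order_encodeGraph : order (encodeGraph G) = n := order_eq (length_encodeGraph G)

theorem lt_length {x : List Bool} (h : x.length = n + 1 + n * n) (u : Fin n) : u < x.length := by
  have := u.2
  rw [h]
  omega

theorem wordAdj_encodeGraph (u v : Fin n) : wordAdj (encodeGraph G) u v ↔ G.Adj u v := by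
  have hlt : u * n + v < n * n := by nlinarith [u.2, v.2]
  rw [wordAdj, order_encodeGraph, min_eq_left (lt_length (length_encodeGraph G) u).le,
    encodeGraph, List.getElem?_append_right (by simp; omega), List.length_replicate,
    show n + 1 + (u * n + v) - n = (u * n + v) + 1 by omega, List.getElem?_cons_succ,
    List.getElem?_eq_getElem (by simpa using hlt), List.getElem_ofFn, Option.some_inj,
    decide_eq_true_iff]
  have hn : 0 < n := u.pos
  have h1 : (⟨u * n + v, hlt⟩ : Fin (n * n)).divNat = u := by
    ext
    simp [Fin.divNat, Nat.add_comm _ (v : ℕ), Nat.add_mul_div_right _ _ hn]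
  have h2 : (⟨u * n + v, hlt⟩ : Fin (n * n)).modNat = v := by
    ext
    simp [Fin.modNat, Nat.mod_eq_of_lt v.2]
  rw [h1, h2]

variable {G} {x : List Bool}

theorem forall_word_iff (hx : x = encodeGraph G) {p : ℕ → Prop} :
    (∀ w < x.length, w < order x → p w) ↔ ∀ w : Fin n, p w := by
  subst hx
  rw [order_encodeGraph]
  exact ⟨fun h w => h w (lt_length (length_encodeGraph G) w) w.2, fun h w _ hw => h ⟨w, hw⟩⟩

theorem exists_word_iff (hx : x = encodeGraph G) {p : ℕ → Prop} :
    (∃ w < x.length, w < order x ∧ p w) ↔ ∃ w : Fin n, p w := by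
  have := (forall_word_iff hx (p := fun w => ¬ p w)).not
  push Not at this
  exact this

theorem sum_word_eq (hx : x = encodeGraph G) {p : ℕ → Prop} [DecidablePred p] :
    (∑ w ∈ Finset.range x.length, if w < order x ∧ p w then 1 else 0) =
      (Finset.univ.filter fun w : Fin n => p w).card := by
  rw [← Finset.sum_filter, ← Finset.card_eq_sum_ones, ← Finset.card_map Fin.valEmbedding]
  congr 1
  subst hx
  ext w
  simp only [order_encodeGraph, Finset.mem_filter, Finset.mem_range, Finset.mem_map,
    Finset.mem_univ, true_and, Fin.valEmbedding_apply]
  constructor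
  · rintro ⟨-, hw, hp⟩
    exact ⟨⟨w, hw⟩, hp, rfl⟩
  · rintro ⟨w, hp, rfl⟩
    exact ⟨lt_length (length_encodeGraph G) w, w.2, hp⟩

theorem wordTwin_iff (hx : x = encodeGraph G) (u v : Fin n) : wordTwin x u v ↔ Twin G u v := by
  rw [wordTwin, forall_word_iff hx]
  simp only [hx, wordAdj_encodeGraph, ne_eq, Fin.val_inj, Twin]

theorem wordIsRep_iff (hx : x = encodeGraph G) (v : Fin n) : wordIsRep x v ↔ IsRep G v := by
  have hv : (v : ℕ) < order x := by rw [hx, order_encodeGraph]; exact v.2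
  have : wordIsRep x v ↔ ∀ u < x.length, u < order x → u < v → ¬ wordTwin x u v :=
    ⟨fun h u hu _ => h u hu, fun h u hu huv => h u hu (huv.trans hv) huv⟩
  rw [this, forall_word_iff hx]
  simp only [wordTwin_iff hx, Fin.val_fin_lt, IsRep]

theorem wordNumReps_eq (hx : x = encodeGraph G) : wordNumReps x = numReps G := by
  rw [wordNumReps, sum_word_eq hx]
  simp only [wordIsRep_iff hx, numReps]

theorem wordClassIndex_eq (hx : x = encodeGraph G) (u : Fin n) :
    wordClassIndex x u = classIndex G u := by
  rw [wordClassIndex, classIndex]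
  refine (sum_word_eq hx
    (p := fun v => wordIsRep x v ∧ ∀ w < x.length, w ≤ v → ¬ wordTwin x w u)).trans ?_
  congr 1
  ext v
  simp only [Finset.mem_filter, Finset.mem_univ, true_and, wordIsRep_iff hx]
  refine and_congr_right fun _ => ?_
  have hv : (v : ℕ) < order x := by rw [hx, order_encodeGraph]; exact v.2
  have : (∀ w < x.length, w ≤ v → ¬ wordTwin x w u) ↔
      ∀ w < x.length, w < order x → w ≤ v → ¬ wordTwin x w u :=
    ⟨fun h w hw _ => h w hw, fun h w hw hwv => h w hw (hwv.trans_lt hv) hwv⟩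
  rw [this, forall_word_iff hx]
  simp only [wordTwin_iff hx, Fin.val_fin_le]

/-- This makes the truncations at the word length harmless, both in the power of two and in `digit`.
-/
theorem numReps_lt_length (hx : x = encodeGraph G) : numReps G < x.length := by
  have := numReps_le G
  rw [hx, length_encodeGraph]
  omega

theorem wordCandidate_iff (hx : x = encodeGraph G) {m : ℕ} (hm : m < 2 ^ numReps G) (u : Fin n) :
    wordCandidate x m u ↔ u ∈ candidate G m := by
  have hu : (u : ℕ) < order x := by rw [hx, order_encodeGraph]; exact u.2
  have hlt := numReps_lt_length hx
  rw [wordCandidate, exists_word_iff hx, wordClassIndex_eq hx, digit_iff_testBit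
    (hm.trans (Nat.pow_lt_pow_right one_lt_two hlt)) ((classIndex_lt u).trans hlt)]
  simp only [hu, true_and, wordIsRep_iff hx, wordTwin_iff hx, ne_eq, Fin.val_inj, candidate,
    Set.mem_ofPred_eq]
  simp only [hx, wordAdj_encodeGraph]

theorem wordIsMaximal_iff (hx : x = encodeGraph G) {m : ℕ} (hm : m < 2 ^ numReps G) :
    wordIsMaximal x m ↔ Maximal G.IsIndepSet (candidate G m) := by
  have hf : ∀ p : ℕ → Prop, (∀ u < x.length, wordCandidate x m u → p u) ↔
      ∀ u : Fin n, u ∈ candidate G m → p u := by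
    intro p
    simp only [← wordCandidate_iff hx hm]
    rw [← forall_word_iff hx (p := fun u => wordCandidate x m u → p u)]
    exact ⟨fun h u hu _ => h u hu, fun h u hu hc => h u hu hc.1 hc⟩
  have he : ∀ p : ℕ → Prop, (∃ u < x.length, wordCandidate x m u ∧ p u) ↔
      ∃ u : Fin n, u ∈ candidate G m ∧ p u := by
    intro p
    have := (hf fun u => ¬ p u).not
    push Not at this
    exact this
  rw [maximal_isIndepSet_iff, wordIsMaximal, forall_word_iff hx]
  simp only [hf, he, wordCandidate_iff hx hm]
  simp only [hx, wordAdj_encodeGraph]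

theorem wordCard_eq (hx : x = encodeGraph G) {m : ℕ} (hm : m < 2 ^ numReps G) :
    wordCard x m = (candidate G m).ncard := by
  have : wordCard x m =
      ∑ u ∈ Finset.range x.length, if u < order x ∧ wordCandidate x m u then 1 else 0 :=
    Finset.sum_congr rfl fun u _ => if_congr ⟨fun h => ⟨h.1, h⟩, fun h => h.2⟩ rfl rfl
  rw [this, sum_word_eq hx, Set.ncard_eq_toFinset_card']
  congr 1
  ext u
  simp [wordCandidate_iff hx hm]

theorem isWellCovered_iff_downFold (hx : x = encodeGraph G) :
    downFold (wordStep x) (2 ^ numReps G) 0 ≠ 1 ↔ IsWellCovered G := by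
  rw [downFold_wordStep_eq_one_iff, isWellCovered_iff_candidate]
  refine forall₂_congr fun m hm => forall₂_congr fun m' hm' => ?_
  rw [wordIsMaximal_iff hx hm, wordIsMaximal_iff hx hm', wordCard_eq hx hm, wordCard_eq hx hm']

theorem wordIsGraph_iff :
    wordIsGraph x ↔ ∃ (n : ℕ) (G : SimpleGraph (Fin n)), 1 ≤ n ∧ x = encodeGraph G := by
  constructor
  · rintro ⟨h1, h2, h3, h4, h5⟩
    generalize hn : order x = n at *
    have hlen : x.length = n + 1 + n * n := by
      rcases le_total n x.length with h | h
      · rwa [min_eq_left h] at h2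
      -- If the truncation were active, the length equation would make the word longer than `n`.
      · rw [min_eq_right h] at h2
        omega
    have hlt := lt_length hlen
    let G : SimpleGraph (Fin n) :=
      { Adj := fun u v => wordAdj x u v
        symm := ⟨fun u v h => (h5 u (hlt u) u.2 v (hlt v) v.2 h).1⟩
        loopless := ⟨fun u h => (h5 u (hlt u) u.2 u (hlt u) u.2 h).2 rfl⟩ }
    refine ⟨n, G, h1, List.ext_getElem (by rw [hlen, length_encodeGraph]) fun i hi hi' => ?_⟩
    have hb : x[i] = true ↔ x[i]? = some true := by
      rw [List.getElem?_eq_getElem hi, Option.some_inj]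
    have hb' : (encodeGraph G)[i] = true ↔ (encodeGraph G)[i]? = some true := by
      rw [List.getElem?_eq_getElem hi', Option.some_inj]
    rw [Bool.eq_iff_iff, hb, hb']
    rcases lt_trichotomy i n with hin | rfl | hin
    · simp [h3 i hi hin, encodeGraph, List.getElem?_append_left, hin]
    · simp [h4, encodeGraph]
    · obtain ⟨e, rfl⟩ : ∃ e, i = n + 1 + e := ⟨i - (n + 1), by omega⟩
      have he : e < n * n := by omega
      have hdiv : e / n < n := Nat.div_lt_of_lt_mul he
      have hmod : e % n < n := Nat.mod_lt _ h1
      -- Matrix position `e` belongs to row `e / n` and column `e % n`.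
      have h6 := wordAdj_encodeGraph G ⟨e / n, hdiv⟩ ⟨e % n, hmod⟩
      have h7 : G.Adj ⟨e / n, hdiv⟩ ⟨e % n, hmod⟩ ↔ wordAdj x (e / n) (e % n) := Iff.rfl
      rw [h7] at h6
      simp only [wordAdj, order_encodeGraph, hn] at h6
      rw [min_eq_left (by rw [length_encodeGraph]; omega), min_eq_left (by omega),
        mul_comm, Nat.div_add_mod] at h6
      exact h6.symm
  · rintro ⟨n, G, h1, rfl⟩
    have hn := order_encodeGraph G
    have hlen := length_encodeGraph G
    refine ⟨by rwa [hn], ?_, fun i _ hi => ?_, ?_, ?_⟩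
    · rw [hn, min_eq_left (by omega), hlen]
    · rw [hn] at hi
      simp [encodeGraph, List.getElem?_append_left, hi]
    · rw [hn]
      simp [encodeGraph]
    · rw [forall_word_iff rfl]
      intro u
      rw [forall_word_iff rfl (p := fun v => wordAdj (encodeGraph G) u v →
        wordAdj (encodeGraph G) v u ∧ (u : ℕ) ≠ v)]
      intro v
      rw [wordAdj_encodeGraph, wordAdj_encodeGraph]
      exact fun h => ⟨h.symm, fun e => h.ne (Fin.ext e)⟩

end Encode

/-! ### Running times -/

open Classical in
theorem isFPT_wellCoveredByND : IsFPT wellCoveredByND := by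
  obtain ⟨P, T, hP⟩ := exists_prog_of_fold
    -- The loop is empty unless the word encodes a graph with exactly `k` twin classes, so it has at
    -- most `2 ^ k` rounds on every input.
    (N := fun a => if wordIsGraph (Ctx.inp a) ∧ wordNumReps (Ctx.inp a) = a.2 then
      2 ^ min (wordNumReps (Ctx.inp a)) (len a) else 0)
    (g := fun a => wordStep (Ctx.inp a) a.1.2 a.2)
    -- An empty loop ends in state `0`, which would pass for acceptance, so the check is repeated.
    (h := fun a => (wordIsGraph (Ctx.inp a) ∧ wordNumReps (Ctx.inp a) = a.1.2) ∧ a.2 ≠ 1)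
    ((polyTimePred_wordIsGraph.and (.eq polyTime_wordNumReps .snd)).ite
      polyTime_wordNumReps.two_pow_min (.const 0))
    (polyTime_wordStep PolyTime.snd.fst .snd)
    ((polyTimePred_wordIsGraph.and (.eq polyTime_wordNumReps PolyTime.snd.fst)).and
      (PolyTimePred.eq .snd (.const 1)).not)
  obtain ⟨K, c, hT⟩ := exists_eval_le_pow T
  refine ⟨P, fun k => 2 * K * 2 ^ k, c, ?_, fun x k => ?_⟩
  · have hpow : Primrec fun k : ℕ => 2 ^ k := by
      refine (Primrec.nat_rec₁ 1 (Primrec.nat_mul.comp Primrec.snd (Primrec.const 2)).to₂).of_eq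
        fun k => ?_
      induction k with
      | zero => rfl
      | succ k ih => rw [pow_succ, ← ih]
    exact (Primrec.nat_mul.comp (Primrec.const (2 * K)) hpow).to_comp
  obtain ⟨t, s, he, ht, hs⟩ := hP x k
  refine ⟨t, s, he, ht.trans ?_, hs.trans ?_⟩
  · have hN : (if wordIsGraph x ∧ wordNumReps x = k then
        2 ^ min (wordNumReps x) x.length else 0) ≤ 2 ^ k := by
      split_ifs with h
      · exact Nat.pow_le_pow_right two_pos (h.2 ▸ min_le_left _ _)
      · exact Nat.zero_le _
    calc _ ≤ (2 ^ k + 1) * (K * (x.length + 1) ^ c) :=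
          Nat.mul_le_mul (Nat.add_le_add_right hN 1) (hT _)
      _ ≤ (2 * 2 ^ k) * (K * instanceSize x k ^ c) := by
          have := Nat.one_le_two_pow (n := k)
          refine Nat.mul_le_mul (by omega) (Nat.mul_le_mul_left _ (Nat.pow_le_pow_left ?_ c))
          unfold instanceSize
          omega
      _ = 2 * K * 2 ^ k * instanceSize x k ^ c := by ring
  · change (wordIsGraph x ∧ wordNumReps x = k) ∧ downFold (fun i acc => wordStep x i acc)
      (if wordIsGraph x ∧ wordNumReps x = k then 2 ^ min (wordNumReps x) x.length else 0) 0 ≠ 1 ↔ _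
    constructor
    · rintro ⟨h, hf⟩
      rw [if_pos h] at hf
      obtain ⟨n, G, hn, hx⟩ := wordIsGraph_iff.1 h.1
      rw [wordNumReps_eq hx, min_eq_left (numReps_lt_length hx).le] at hf
      refine ⟨n, G, hn, hx, ?_, (isWellCovered_iff_downFold hx).1 hf⟩
      rw [neighborhoodDiversity_eq, ← wordNumReps_eq hx, h.2]
    · rintro ⟨n, G, hn, hx, hk, hG⟩
      replace hx : x = encodeGraph G := hx
      have h : wordIsGraph x ∧ wordNumReps x = k := by
        refine ⟨wordIsGraph_iff.2 ⟨n, G, hn, hx⟩, ?_⟩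
        rw [wordNumReps_eq hx, ← neighborhoodDiversity_eq]
        exact hk
      refine ⟨h, ?_⟩
      rw [if_pos h, wordNumReps_eq hx, min_eq_left (numReps_lt_length hx).le]
      exact (isWellCovered_iff_downFold hx).2 hG

theorem exists_prog_isWellCovered :
    ∃ (P : Prog) (C c : ℕ), ∀ (n : ℕ) (G : SimpleGraph (Fin n)), 1 ≤ n →
      P.AnswersWithin (encodeGraph G) 0 (IsWellCovered G)
        (C * 2 ^ neighborhoodDiversity G * n ^ c) := by
  obtain ⟨P, T, hP⟩ := exists_prog_of_fold
    (N := fun a => 2 ^ min (wordNumReps (Ctx.inp a)) (len a))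
    (g := fun a => wordStep (Ctx.inp a) a.1.2 a.2) (h := fun a => a.2 ≠ 1)
    polyTime_wordNumReps.two_pow_min (polyTime_wordStep PolyTime.snd.fst .snd)
    (PolyTimePred.eq .snd (.const 1)).not
  obtain ⟨K, c, hT⟩ := exists_eval_le_pow T
  -- The code length plus one is `n ^ 2 + n + 2`, at most `4 * n ^ 2` for `n ≥ 1`; the factor `2`
  -- absorbs the `+ 1` in the number of rounds.
  refine ⟨P, 2 * K * 4 ^ c, 2 * c, fun n G hn => ?_⟩
  have hmin : min (wordNumReps (encodeGraph G)) (encodeGraph G).length = numReps G := by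
    rw [wordNumReps_eq rfl, min_eq_left (numReps_lt_length rfl).le]
  obtain ⟨t, s, he, ht, hs⟩ := hP (encodeGraph G) 0
  change t ≤ (2 ^ min (wordNumReps (encodeGraph G)) (encodeGraph G).length + 1) * _ at ht
  change s.reg 0 ≠ 0 ↔ downFold (fun i acc => wordStep (encodeGraph G) i acc)
    (2 ^ min (wordNumReps (encodeGraph G)) (encodeGraph G).length) 0 ≠ 1 at hs
  rw [hmin] at ht hs
  refine ⟨t, s, he, ht.trans ?_, hs.trans (isWellCovered_iff_downFold rfl)⟩
  rw [neighborhoodDiversity_eq]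
  calc _ ≤ (2 ^ numReps G + 1) * (K * ((encodeGraph G).length + 1) ^ c) :=
        Nat.mul_le_mul_left _ (hT _)
    _ ≤ (2 * 2 ^ numReps G) * (K * (4 * n ^ 2) ^ c) := by
        have := Nat.one_le_two_pow (n := numReps G)
        refine Nat.mul_le_mul (by omega) (Nat.mul_le_mul_left _ (Nat.pow_le_pow_left ?_ c))
        rw [length_encodeGraph]
        nlinarith
    _ = 2 * K * 4 ^ c * 2 ^ numReps G * n ^ (2 * c) := by rw [mul_pow, ← pow_mul]; ring

end WellCovered

theorem mainTheorem11 :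
    -- Well-Covered Graph parameterized by neighborhood diversity is fixed-parameter tractable;
    WellCovered.IsFPT WellCovered.wellCoveredByND ∧
    -- given only `G` (the parameter register holds `0`), the time is `2 ^ nd(G) * n ^ O(1)`;
    (∃ (P : WellCovered.Prog) (C c : ℕ), ∀ (n : ℕ) (G : SimpleGraph (Fin n)), 1 ≤ n →
      P.AnswersWithin (WellCovered.encodeGraph G) 0 (WellCovered.IsWellCovered G)
        (C * 2 ^ WellCovered.neighborhoodDiversity G * n ^ c)) ∧
    -- and the weighted quotient decides whether `G` is well-covered.
    (∀ (n t : ℕ) (G : SimpleGraph (Fin n)) (p : Fin n → Fin t),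
      WellCovered.IsNeighborhoodPartition G p →
        (WellCovered.IsWellCovered G ↔
          ∀ S T : Finset (Fin t),
            Maximal (WellCovered.quotientGraph G p).IsIndepSet (S : Set (Fin t)) →
            Maximal (WellCovered.quotientGraph G p).IsIndepSet (T : Set (Fin t)) →
            ∑ i ∈ S, WellCovered.partWeight G p i = ∑ i ∈ T, WellCovered.partWeight G p i)) := by
  exact ⟨WellCovered.isFPT_wellCoveredByND, WellCovered.exists_prog_isWellCovered,
    fun _ _ _ _ hp => WellCovered.isWellCovered_iff_quotient hp⟩
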